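/- Let $X$ and $Y$ be disjoint finite sets and let $G$ be a bipartite graph with sides $X$ and $Y$ and edge set $E \subseteq X \times Y$, with a weight function $w : E \to \mathbb{R}$ and a capacity function $c : X \to \mathbb{Z}$ with $c(x) \ge 0$ for all $x \in X$. Suppose that every vertex $y \in Y$ has degree at most $p$ in $G$. For $S \subseteq X$, a capacity-respecting matching in the subgraph induced by $S \cup Y$ is a set $M$ of edges between $S$ and $Y$ such that each $x \in S$ belongs to at most $c(x)$ edges of $M$ and each $y \in Y$ belongs to at most one edge of $M$. Let $v(S)$ be the maximum of $\sum_{e \in M} w(e)$ over all such $M$. Then the maximum defining $v(S)$ exists for every $S \subseteq X$, and the following hold. 1. (Weighted-B-Matching is the maximization of $v$.) For an integer $K \ge 0$, the Weighted-B-Matching problem asks for a set $M \subseteq E$ of maximum total weight such that each $x \in X$ belongs to at most $c(x)$ edges of $M$, each $y \in Y$ belongs to at most one edge of $M$, and at most $K$ vertices of $X$ belong to some edge of $M$. For every $K$, the optimal value of this problem equals $\max\{v(S) : S \subseteq X,\ |S| \le K\}$, and $M$ is an optimal solution if and only if there is a set $S$ attaining this last maximum such that $M$ is a maximum-weight capacity-respecting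 matching in the subgraph induced by $S \cup Y$. 2. $v$ is non-negative: $v(S) \ge 0$ for all $S \subseteq X$. 3. $v$ is non-decreasing: $v(A) \le v(B)$ whenever $A \subseteq B \subseteq X$. 4. $v$ is submodular: $v(A \cup \{x\}) - v(A) \ge v(B \cup \{x\}) - v(B)$ whenever $A \subseteq B \subseteq X$ and $x \in X \setminus B$. 5. $v$ is $p$-superseparable: for every $S \subseteq X$, $$\sum_{x \in X} \bigl(v(S \cup \{x\}) - v(S)\bigr) \ \ge\ \sum_{x \in X} v(\{x\}) - p \cdot v(S).$$ -/

import Mathlib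

/-- Submodularity of a set function: diminishing marginal contributions. -/
def IsSubmodular {X : Type*} [DecidableEq X] (v : Finset X → ℝ) : Prop :=
  ∀ A B : Finset X, A ⊆ B → ∀ x : X, x ∉ B → v (B ∪ {x}) - v B ≤ v (A ∪ {x}) - v A

/-- The inequality of `p`-superseparability of a set function on a finite universe. -/
def IsSuperseparable {X : Type*} [Fintype X] [DecidableEq X] (p : ℝ) (v : Finset X → ℝ) : Prop :=
  ∀ S : Finset X, (∑ x : X, v {x}) - p * v S ≤ ∑ x : X, (v (S ∪ {x}) - v S)

/-- `S` has at most `K` elements and maximal value of `v` among all such sets. -/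
def IsBestKSubset {X : Type*} (v : Finset X → ℝ) (K : ℕ) (S : Finset X) : Prop :=
  S.card ≤ K ∧ ∀ T : Finset X, T.card ≤ K → v T ≤ v S

/-- The data of a weighted b-matching instance: a bipartite graph with sides `X` and `Y`, edge
weights (only the values on `edges` are ever used), and capacities on `X`. -/
structure BMatchingInstance (X Y : Type*) where
  edges : Finset (X × Y)
  weight : X × Y → ℝ
  capacity : X → ℤ

namespace BMatchingInstance

variable {X Y : Type*} [DecidableEq X] [DecidableEq Y] (I : BMatchingInstance X Y)

/-- The number of edges at the vertex `y`. -/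
def degreeY (y : Y) : ℕ := (I.edges.filter fun e => e.2 = y).card

/-- Total weight of a set of edges. -/
def totalWeight (M : Finset (X × Y)) : ℝ := ∑ e ∈ M, I.weight e

/-- The edges of the subgraph induced by `S ∪ Y`. -/
def inducedEdges (S : Finset X) : Finset (X × Y) := I.edges.filter fun e => e.1 ∈ S

/-- `M` is a capacity-respecting matching in the subgraph induced by `S ∪ Y`. -/
def IsMatching (S : Finset X) (M : Finset (X × Y)) : Prop :=
  M ⊆ I.inducedEdges S ∧
  (∀ x ∈ S, ((M.filter fun e => e.1 = x).card : ℤ) ≤ I.capacity x) ∧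
  ∀ y : Y, (M.filter fun e => e.2 = y).card ≤ 1

/-- `M` is a maximum-weight capacity-respecting matching in the subgraph induced by `S ∪ Y`. -/
def IsMaxMatching (S : Finset X) (M : Finset (X × Y)) : Prop :=
  I.IsMatching S M ∧ ∀ N, I.IsMatching S N → I.totalWeight N ≤ I.totalWeight M

/-- The maximum weight of a capacity-respecting matching in the subgraph induced by `S ∪ Y`. -/
noncomputable def value (S : Finset X) : ℝ :=
  sSup {r : ℝ | ∃ M, I.IsMatching S M ∧ I.totalWeight M = r}

/-- Feasible solutions of the weighted b-matching problem with bound `K` on the number of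
vertices of `X` that are used. -/
def IsFeasible (K : ℕ) (M : Finset (X × Y)) : Prop :=
  M ⊆ I.edges ∧
  (∀ x : X, ((M.filter fun e => e.1 = x).card : ℤ) ≤ I.capacity x) ∧
  (∀ y : Y, (M.filter fun e => e.2 = y).card ≤ 1) ∧
  (M.image Prod.fst).card ≤ K

/-- Optimal solutions of the weighted b-matching problem with bound `K`. -/
def IsOptimal (K : ℕ) (M : Finset (X × Y)) : Prop :=
  I.IsFeasible K M ∧ ∀ N, I.IsFeasible K N → I.totalWeight N ≤ I.totalWeight M

end BMatchingInstance

/-! For part 1, a feasible `M` is a matching on the set of vertices it uses, and a matching on at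
most `K` vertices is feasible (`isOptimal_iff`).

Submodularity is an exchange argument. Let `M` be optimal for `B ∪ {x}` and `N` for `A`.
`exists_exchange_set` gives `R ⊆ M` containing the edges at `x`; with `Q` the edges of `N`
conflicting with `R`, swapping `R` and `Q` turns `N` into a matching on `A ∪ {x}` and `M` into one
on `B`. Total weight is preserved, so `v(A ∪ {x}) + v(B) ≥ v(B ∪ {x}) + v(A)`.

For superseparability, an optimal matching of `{x}` can be inserted into an optimal `M` for `S`
after deleting the edges of `M` at neighbours of `x` (`value_singleton_le`). Over all `x`, an edge
`e` of `M` is deleted `deg(e.2) ≤ p` times, and its weight is non-negative, so the total loss is at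
most `p * v(S)`. -/

lemma exists_isBestKSubset {X : Type*} [Fintype X] (v : Finset X → ℝ) (K : ℕ) :
    ∃ S, IsBestKSubset v K S := by
  obtain ⟨S, hS, hmax⟩ := Finset.exists_max_image
    (Finset.univ.filter fun S : Finset X => S.card ≤ K) v ⟨∅, by simp⟩
  exact ⟨S, (Finset.mem_filter.1 hS).2,
    fun T hT => hmax T (Finset.mem_filter.2 ⟨Finset.mem_univ _, hT⟩)⟩

namespace BMatchingInstance

variable {X Y : Type*} [DecidableEq X] [DecidableEq Y] {I : BMatchingInstance X Y}

lemma IsMatching.mem_edges {S : Finset X} {M : Finset (X × Y)} (h : I.IsMatching S M)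
    {e : X × Y} (he : e ∈ M) : e ∈ I.edges :=
  (Finset.mem_filter.1 (h.1 he)).1

lemma IsMatching.fst_mem {S : Finset X} {M : Finset (X × Y)} (h : I.IsMatching S M)
    {e : X × Y} (he : e ∈ M) : e.1 ∈ S :=
  (Finset.mem_filter.1 (h.1 he)).2

lemma IsMatching.eq_of_snd_eq {S : Finset X} {M : Finset (X × Y)} (h : I.IsMatching S M)
    {e f : X × Y} (he : e ∈ M) (hf : f ∈ M) (hef : e.2 = f.2) : e = f :=
  Finset.card_le_one.1 (h.2.2 f.2) e (Finset.mem_filter.2 ⟨he, hef⟩) f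
    (Finset.mem_filter.2 ⟨hf, rfl⟩)

lemma isMatching_of_forall {S : Finset X} {M : Finset (X × Y)}
    (hE : ∀ e ∈ M, e ∈ I.edges ∧ e.1 ∈ S)
    (hX : ∀ x ∈ S, ((M.filter fun e => e.1 = x).card : ℤ) ≤ I.capacity x)
    (hY : ∀ e ∈ M, ∀ f ∈ M, e.2 = f.2 → e = f) : I.IsMatching S M := by
  refine ⟨fun e he => Finset.mem_filter.2 (hE e he), hX, fun y => Finset.card_le_one.2 ?_⟩
  intro e he f hf
  rw [Finset.mem_filter] at he hf
  exact hY e he.1 f hf.1 (he.2.trans hf.2.symm)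

/-- A subset of a matching is a matching. -/
lemma IsMatching.subset {S : Finset X} {M N : Finset (X × Y)} (h : I.IsMatching S M)
    (hNM : N ⊆ M) : I.IsMatching S N := by
  refine isMatching_of_forall (fun e he => ⟨h.mem_edges (hNM he), h.fst_mem (hNM he)⟩)
    (fun x hx => ?_) (fun e he f hf => h.eq_of_snd_eq (hNM he) (hNM hf))
  refine le_trans ?_ (h.2.1 x hx)
  exact_mod_cast Finset.card_le_card (Finset.filter_subset_filter _ hNM)

/-- Outside `S` there are no edges, so non-negative capacity suffices; this lets matchings pass
between vertex sets. -/
lemma IsMatching.card_filter_fst_le (hc : ∀ x : X, 0 ≤ I.capacity x) {S : Finset X}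
    {M : Finset (X × Y)} (h : I.IsMatching S M) (x : X) :
    ((M.filter fun e => e.1 = x).card : ℤ) ≤ I.capacity x := by
  by_cases hx : x ∈ S
  · exact h.2.1 x hx
  · have : (M.filter fun e => e.1 = x) = ∅ :=
      Finset.filter_eq_empty_iff.2 fun e he hex => hx (hex ▸ h.fst_mem he)
    simpa [this] using hc x

/-- Enlarging the set of allowed vertices keeps matchings. -/
lemma IsMatching.mono (hc : ∀ x : X, 0 ≤ I.capacity x) {S T : Finset X}
    {M : Finset (X × Y)} (h : I.IsMatching S M) (hST : S ⊆ T) : I.IsMatching T M :=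
  isMatching_of_forall (fun _ he => ⟨h.mem_edges he, hST (h.fst_mem he)⟩)
    (fun x _ => h.card_filter_fst_le hc x) (fun _ he _ hf => h.eq_of_snd_eq he hf)

lemma isMatching_empty (hc : ∀ x : X, 0 ≤ I.capacity x) (S : Finset X) : I.IsMatching S ∅ :=
  isMatching_of_forall (by simp) (fun x _ => by simpa using hc x) (by simp)

lemma exists_isMaxMatching (hc : ∀ x : X, 0 ≤ I.capacity x) (S : Finset X) :
    ∃ M, I.IsMaxMatching S M := by
  classical
  obtain ⟨M, hM, hmax⟩ := Finset.exists_max_image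
    (I.edges.powerset.filter fun M => I.IsMatching S M) I.totalWeight
    ⟨∅, by simp [isMatching_empty hc]⟩
  refine ⟨M, (Finset.mem_filter.1 hM).2, fun N hN => hmax N ?_⟩
  exact Finset.mem_filter.2 ⟨Finset.mem_powerset.2 fun _ he => hN.mem_edges he, hN⟩

lemma IsMaxMatching.isGreatest {S : Finset X} {M : Finset (X × Y)} (h : I.IsMaxMatching S M) :
    IsGreatest {r : ℝ | ∃ M, I.IsMatching S M ∧ I.totalWeight M = r} (I.totalWeight M) := by
  refine ⟨⟨M, h.1, rfl⟩, ?_⟩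
  rintro _ ⟨N, hN, rfl⟩
  exact h.2 N hN

lemma IsMaxMatching.totalWeight_eq {S : Finset X} {M : Finset (X × Y)}
    (h : I.IsMaxMatching S M) : I.totalWeight M = I.value S :=
  h.isGreatest.csSup_eq.symm

lemma IsMatching.totalWeight_le_value (hc : ∀ x : X, 0 ≤ I.capacity x) {S : Finset X}
    {M : Finset (X × Y)} (h : I.IsMatching S M) : I.totalWeight M ≤ I.value S := by
  obtain ⟨N, hN⟩ := exists_isMaxMatching hc S
  exact hN.totalWeight_eq ▸ hN.2 M h

lemma value_nonneg (hc : ∀ x : X, 0 ≤ I.capacity x) (S : Finset X) : 0 ≤ I.value S := by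
  simpa [totalWeight] using (isMatching_empty hc S).totalWeight_le_value hc

lemma value_mono (hc : ∀ x : X, 0 ≤ I.capacity x) : Monotone I.value := by
  intro S T hST
  obtain ⟨M, hM⟩ := exists_isMaxMatching hc S
  rw [← hM.totalWeight_eq]
  exact (hM.1.mono hc hST).totalWeight_le_value hc

/-- The edges of a maximum-weight matching have non-negative weight. -/
lemma IsMaxMatching.weight_nonneg {S : Finset X} {M : Finset (X × Y)}
    (h : I.IsMaxMatching S M) {e : X × Y} (he : e ∈ M) : 0 ≤ I.weight e := by
  have h1 := h.2 _ (h.1.subset (M.erase_subset e))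
  have h2 := Finset.add_sum_erase M I.weight he
  unfold totalWeight at h1
  linarith

/-! ### The cardinality-constrained problem -/

lemma IsMatching.isFeasible (hc : ∀ x : X, 0 ≤ I.capacity x) {S : Finset X} {K : ℕ}
    {M : Finset (X × Y)} (h : I.IsMatching S M) (hS : S.card ≤ K) : I.IsFeasible K M := by
  refine ⟨fun _ he => h.mem_edges he, h.card_filter_fst_le hc, h.2.2, ?_⟩
  refine (Finset.card_le_card fun x hx => ?_).trans hS
  obtain ⟨e, he, rfl⟩ := Finset.mem_image.1 hx
  exact h.fst_mem he

lemma IsFeasible.isMatching {K : ℕ} {M : Finset (X × Y)} (h : I.IsFeasible K M) :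
    I.IsMatching (M.image Prod.fst) M :=
  ⟨fun _ he => Finset.mem_filter.2 ⟨h.1 he, Finset.mem_image_of_mem _ he⟩,
    fun x _ => h.2.1 x, h.2.2.1⟩

lemma isOptimal_iff (hc : ∀ x : X, 0 ≤ I.capacity x) (K : ℕ) (M : Finset (X × Y)) :
    I.IsOptimal K M ↔ ∃ S : Finset X, IsBestKSubset I.value K S ∧ I.IsMaxMatching S M := by
  constructor
  · rintro ⟨hM, hopt⟩
    refine ⟨M.image Prod.fst, ⟨hM.2.2.2, fun T hT => ?_⟩, hM.isMatching,
      fun N hN => hopt N (hN.isFeasible hc hM.2.2.2)⟩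
    obtain ⟨N, hN⟩ := exists_isMaxMatching hc T
    rw [← hN.totalWeight_eq]
    exact (hopt N (hN.1.isFeasible hc hT)).trans (hM.isMatching.totalWeight_le_value hc)
  · rintro ⟨S, hS, hM⟩
    refine ⟨hM.1.isFeasible hc hS.1, fun N hN => ?_⟩
    rw [hM.totalWeight_eq]
    exact (hN.isMatching.totalWeight_le_value hc).trans (hS.2 _ hN.2.2.2)

lemma exists_common_optimum [Fintype X] (hc : ∀ x : X, 0 ≤ I.capacity x) (K : ℕ) :
    ∃ r : ℝ, IsGreatest {s : ℝ | ∃ M, I.IsFeasible K M ∧ I.totalWeight M = s} r ∧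
      IsGreatest {s : ℝ | ∃ S : Finset X, S.card ≤ K ∧ I.value S = s} r := by
  obtain ⟨S, hS⟩ := exists_isBestKSubset I.value K
  obtain ⟨M, hM⟩ := exists_isMaxMatching hc S
  have hopt := (isOptimal_iff hc K M).2 ⟨S, hS, hM⟩
  refine ⟨I.value S, ⟨⟨M, hopt.1, hM.totalWeight_eq⟩, ?_⟩, ⟨S, hS.1, rfl⟩, ?_⟩
  · rintro _ ⟨N, hN, rfl⟩
    exact hM.totalWeight_eq ▸ hopt.2 N hN
  · rintro _ ⟨T, hT, rfl⟩
    exact hS.2 T hT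

/-! ### Submodularity -/

/-- The edges of `N` that share their endpoint in `Y` with some edge of `R`. -/
def conflicting (N R : Finset (X × Y)) : Finset (X × Y) :=
  N.filter fun e => e.2 ∈ R.image Prod.snd

lemma mem_conflicting {N R : Finset (X × Y)} {e : X × Y} :
    e ∈ conflicting N R ↔ e ∈ N ∧ ∃ f ∈ R, f.2 = e.2 := by
  rw [conflicting, Finset.mem_filter, Finset.mem_image]

lemma conflicting_mono (N : Finset (X × Y)) {R R' : Finset (X × Y)} (h : R ⊆ R') :
    conflicting N R ⊆ conflicting N R' := fun e he => by
  obtain ⟨heN, f, hf, hfe⟩ := mem_conflicting.1 he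
  exact mem_conflicting.2 ⟨heN, f, h hf, hfe⟩

/-- A set of edges of `M` that contains all edges at `x`, uses only vertices of `A ∪ {x}`, and can
replace the edges of `N` conflicting with it, such that these in turn can replace it in `M`. -/
lemma exists_exchange_set {A S : Finset X} {M N : Finset (X × Y)} {x : X}
    (hx : x ∉ A) (hAS : A ⊆ S) (hM : I.IsMatching S M) (hN : I.IsMatching A N) :
    ∃ R ⊆ M, (∀ e ∈ M, e.1 = x → e ∈ R) ∧ (∀ e ∈ R, e.1 ∈ A ∪ {x}) ∧
      (∀ u ∈ A, (R.filter fun e => e.1 = u).card ≤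
        ((conflicting N R).filter fun e => e.1 = u).card) ∧
      ∀ u ∈ A, (((M \ R).filter fun e => e.1 = u).card : ℤ) +
        ((conflicting N R).filter fun e => e.1 = u).card ≤ I.capacity u := by
  classical
  -- A largest `R` with these properties replaces the tracing of alternating paths from `x`.
  let P : Finset (X × Y) → Prop := fun R =>
    (∀ e ∈ M, e.1 = x → e ∈ R) ∧ (∀ e ∈ R, e.1 ∈ A ∪ {x}) ∧
      ∀ u ∈ A, (R.filter fun e => e.1 = u).card ≤
        ((conflicting N R).filter fun e => e.1 = u).card
  have hP : P (M.filter fun e => e.1 = x) := by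
    refine ⟨fun e he hex => Finset.mem_filter.2 ⟨he, hex⟩, fun e he => ?_, fun u hu => ?_⟩
    · simp [(Finset.mem_filter.1 he).2]
    · have : ((M.filter fun e => e.1 = x).filter fun e => e.1 = u) = ∅ := by
        refine Finset.filter_eq_empty_iff.2 fun e he heu => hx ?_
        rwa [← (Finset.mem_filter.1 he).2, heu]
      simp [this]
  obtain ⟨R, hR, hmax⟩ := Finset.exists_max_image (M.powerset.filter P) Finset.card
    ⟨_, Finset.mem_filter.2 ⟨Finset.mem_powerset.2 (Finset.filter_subset _ _), hP⟩⟩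
  obtain ⟨hRM, hRx, hRA, hRN⟩ : R ⊆ M ∧ P R :=
    ⟨Finset.mem_powerset.1 (Finset.mem_filter.1 hR).1, (Finset.mem_filter.1 hR).2⟩
  refine ⟨R, hRM, hRx, hRA, hRN, fun u hu => ?_⟩
  -- If capacity fails at `u`, then `Q` has more edges at `u` than `R`, because `M` respects the
  -- capacity; and `M \ R` has an edge at `u`, because `Q` alone respects it. Adding that edge to
  -- `R` contradicts maximality.
  by_contra! hlt
  have hQ : (((conflicting N R).filter fun e => e.1 = u).card : ℤ) ≤ I.capacity u :=
    (hN.subset (Finset.filter_subset _ _)).2.1 u hu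
  have hsplit : ((M \ R).filter fun e => e.1 = u).card + (R.filter fun e => e.1 = u).card =
      (M.filter fun e => e.1 = u).card := by
    rw [← Finset.card_union_of_disjoint
      (Finset.disjoint_filter_filter Finset.sdiff_disjoint), ← Finset.filter_union,
      Finset.sdiff_union_of_subset hRM]
  have hMu := hM.2.1 u (hAS hu)
  obtain ⟨e, he⟩ : ((M \ R).filter fun e => e.1 = u).Nonempty := by
    rw [← Finset.card_pos]; omega
  obtain ⟨heMR, heu⟩ := Finset.mem_filter.1 he
  obtain ⟨heM, heR⟩ := Finset.mem_sdiff.1 heMR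
  have hmono := conflicting_mono N (Finset.subset_insert e R)
  have hins : P (insert e R) := by
    refine ⟨fun f hf hfx => Finset.mem_insert_of_mem (hRx f hf hfx), fun f hf => ?_,
      fun t ht => ?_⟩
    · rcases Finset.mem_insert.1 hf with rfl | hf
      · exact Finset.mem_union_left _ (heu ▸ hu)
      · exact hRA f hf
    · refine le_trans ?_ (Finset.card_le_card (Finset.filter_subset_filter _ hmono))
      rw [Finset.filter_insert]
      split_ifs with het
      · obtain rfl : u = t := heu.symm.trans het
        refine (Finset.card_insert_le _ _).trans ?_
        omega
      · exact hRN t ht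
  have := hmax (insert e R) (Finset.mem_filter.2
    ⟨Finset.mem_powerset.2 (Finset.insert_subset heM hRM), hins⟩)
  rw [Finset.card_insert_of_notMem heR] at this
  omega

lemma isSubmodular_value (hc : ∀ x : X, 0 ≤ I.capacity x) : IsSubmodular I.value := by
  intro A B hAB x hx
  obtain ⟨M, hM⟩ := exists_isMaxMatching hc (B ∪ {x})
  obtain ⟨N, hN⟩ := exists_isMaxMatching hc A
  have hxA : x ∉ A := fun h => hx (hAB h)
  obtain ⟨R, hRM, hRx, hRA, hRN, hMR⟩ := exists_exchange_set hxA
    (hAB.trans Finset.subset_union_left) hM.1 hN.1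
  set Q := conflicting N R with hQ
  have hQN : Q ⊆ N := Finset.filter_subset _ _
  have hRQ : ∀ e ∈ R, ∀ f ∈ N \ Q, e.2 ≠ f.2 := fun e he f hf hef =>
    (Finset.mem_sdiff.1 hf).2 (mem_conflicting.2 ⟨(Finset.mem_sdiff.1 hf).1, e, he, hef⟩)
  -- The endpoint in `Y` of an edge of `Q` is already covered by an edge of `R`, the only edge of
  -- `M` there.
  have hQR : ∀ e ∈ M \ R, ∀ f ∈ Q, e.2 ≠ f.2 := fun e he f hf hef => by
    obtain ⟨-, g, hg, hgf⟩ := mem_conflicting.1 hf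
    obtain rfl := hM.1.eq_of_snd_eq (Finset.mem_sdiff.1 he).1 (hRM hg) (hef.trans hgf.symm)
    exact (Finset.mem_sdiff.1 he).2 hg
  have hd₁ : Disjoint R (N \ Q) :=
    Finset.disjoint_left.2 fun e he he' => hRQ e he e he' rfl
  have hd₂ : Disjoint (M \ R) Q :=
    Finset.disjoint_left.2 fun e he he' => hQR e he e he' rfl
  have h₁ : I.IsMatching (A ∪ {x}) (R ∪ (N \ Q)) := by
    refine isMatching_of_forall (fun e he => ?_) (fun u hu => ?_) (fun e he f hf hef => ?_)
    · rcases Finset.mem_union.1 he with he | he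
      · exact ⟨hM.1.mem_edges (hRM he), hRA e he⟩
      · have := (Finset.mem_sdiff.1 he).1
        exact ⟨hN.1.mem_edges this, Finset.mem_union_left _ (hN.1.fst_mem this)⟩
    · rcases Finset.mem_union.1 hu with hu | hu
      · have hsplit : ((N \ Q).filter fun e => e.1 = u).card +
            (Q.filter fun e => e.1 = u).card = (N.filter fun e => e.1 = u).card := by
          rw [← Finset.card_union_of_disjoint
            (Finset.disjoint_filter_filter Finset.sdiff_disjoint), ← Finset.filter_union,
            Finset.sdiff_union_of_subset hQN]
        have hle := Finset.card_union_le (R.filter fun e => e.1 = u)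
          ((N \ Q).filter fun e => e.1 = u)
        rw [← Finset.filter_union] at hle
        -- At `u ∈ A`, `R` adds no more edges than removing `Q` frees.
        have := hN.1.2.1 u hu
        have := hRN u hu
        omega
      · obtain rfl := Finset.mem_singleton.1 hu
        refine le_trans ?_ (hM.1.card_filter_fst_le hc u)
        norm_cast
        refine Finset.card_le_card fun e he => ?_
        obtain ⟨he, heu⟩ := Finset.mem_filter.1 he
        refine Finset.mem_filter.2 ⟨?_, heu⟩
        rcases Finset.mem_union.1 he with he | he
        · exact hRM he
        · exact absurd (heu ▸ hN.1.fst_mem (Finset.mem_sdiff.1 he).1) hxA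
    · rcases Finset.mem_union.1 he with he | he <;> rcases Finset.mem_union.1 hf with hf | hf
      · exact hM.1.eq_of_snd_eq (hRM he) (hRM hf) hef
      · exact absurd hef (hRQ e he f hf)
      · exact absurd hef.symm (hRQ f hf e he)
      · exact hN.1.eq_of_snd_eq (Finset.mem_sdiff.1 he).1 (Finset.mem_sdiff.1 hf).1 hef
  have h₂ : I.IsMatching B ((M \ R) ∪ Q) := by
    refine isMatching_of_forall (fun e he => ?_) (fun u hu => ?_) (fun e he f hf hef => ?_)
    · rcases Finset.mem_union.1 he with he | he
      · obtain ⟨heM, heR⟩ := Finset.mem_sdiff.1 he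
        refine ⟨hM.1.mem_edges heM, ?_⟩
        rcases Finset.mem_union.1 (hM.1.fst_mem heM) with h | h
        · exact h
        · exact absurd (hRx e heM (Finset.mem_singleton.1 h)) heR
      · exact ⟨hN.1.mem_edges (hQN he), hAB (hN.1.fst_mem (hQN he))⟩
    · by_cases huA : u ∈ A
      · have hle := Finset.card_union_le ((M \ R).filter fun e => e.1 = u)
          (Q.filter fun e => e.1 = u)
        rw [← Finset.filter_union] at hle
        have := hMR u huA
        omega
      · refine le_trans ?_ (hM.1.card_filter_fst_le hc u)
        norm_cast
        refine Finset.card_le_card fun e he => ?_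
        obtain ⟨he, heu⟩ := Finset.mem_filter.1 he
        refine Finset.mem_filter.2 ⟨?_, heu⟩
        rcases Finset.mem_union.1 he with he | he
        · exact (Finset.mem_sdiff.1 he).1
        · exact absurd (heu ▸ hN.1.fst_mem (hQN he)) huA
    · rcases Finset.mem_union.1 he with he | he <;> rcases Finset.mem_union.1 hf with hf | hf
      · exact hM.1.eq_of_snd_eq (Finset.mem_sdiff.1 he).1 (Finset.mem_sdiff.1 hf).1 hef
      · exact absurd hef (hQR e he f hf)
      · exact absurd hef.symm (hQR f hf e he)
      · exact hN.1.eq_of_snd_eq (hQN he) (hQN hf) hef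
  have hw₁ := h₁.totalWeight_le_value hc
  have hw₂ := h₂.totalWeight_le_value hc
  rw [← hM.totalWeight_eq, ← hN.totalWeight_eq]
  unfold totalWeight at *
  rw [Finset.sum_union hd₁] at hw₁
  rw [Finset.sum_union hd₂] at hw₂
  have := Finset.sum_sdiff (f := I.weight) hRM
  have := Finset.sum_sdiff (f := I.weight) hQN
  linarith

/-! ### Superseparability -/

/-- Replacing the edges of a matching at the neighbours of `x` by an optimal matching of `x`. -/
lemma value_singleton_le (hc : ∀ x : X, 0 ≤ I.capacity x) {S : Finset X} {M : Finset (X × Y)}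
    (hM : I.IsMaxMatching S M) (x : X) :
    I.value {x} - ∑ e ∈ M.filter (fun e => (x, e.2) ∈ I.edges), I.weight e ≤
      I.value (S ∪ {x}) - I.value S := by
  obtain ⟨L, hL⟩ := exists_isMaxMatching hc {x}
  set M' := M.filter fun e => (x, e.2) ∉ I.edges with hM'
  have hM'M : M' ⊆ M := Finset.filter_subset _ _
  have hLx : ∀ e ∈ L, e.1 = x := fun e he => Finset.mem_singleton.1 (hL.1.fst_mem he)
  have hLM : ∀ e ∈ L, ∀ f ∈ M', e.2 ≠ f.2 := fun e he f hf hef => by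
    refine (Finset.mem_filter.1 hf).2 ?_
    rw [← hef, ← hLx e he]
    exact hL.1.mem_edges he
  -- Covers `x ∈ S` too: edges of `M` at `x` are themselves deleted, so `L` alone uses the capacity
  -- of `x`.
  have hM'x : ∀ e ∈ M', e.1 ≠ x := fun e he hex => by
    refine (Finset.mem_filter.1 he).2 ?_
    rw [← hex]
    exact hM.1.mem_edges (hM'M he)
  have hd : Disjoint L M' := Finset.disjoint_left.2 fun e he he' => hLM e he e he' rfl
  have h : I.IsMatching (S ∪ {x}) (L ∪ M') := by
    refine isMatching_of_forall (fun e he => ?_) (fun u _ => ?_) (fun e he f hf hef => ?_)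
    · rcases Finset.mem_union.1 he with he | he
      · exact ⟨hL.1.mem_edges he, Finset.mem_union_right _ (hL.1.fst_mem he)⟩
      · exact ⟨hM.1.mem_edges (hM'M he), Finset.mem_union_left _ (hM.1.fst_mem (hM'M he))⟩
    · by_cases hux : u = x
      · refine le_trans ?_ (hL.1.card_filter_fst_le hc u)
        norm_cast
        refine Finset.card_le_card fun e he => ?_
        obtain ⟨he, heu⟩ := Finset.mem_filter.1 he
        refine Finset.mem_filter.2 ⟨?_, heu⟩
        exact (Finset.mem_union.1 he).resolve_right fun he => hM'x e he (heu.trans hux)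
      · refine le_trans ?_ (hM.1.card_filter_fst_le hc u)
        norm_cast
        refine Finset.card_le_card fun e he => ?_
        obtain ⟨he, heu⟩ := Finset.mem_filter.1 he
        refine Finset.mem_filter.2 ⟨?_, heu⟩
        exact hM'M ((Finset.mem_union.1 he).resolve_left fun he => hux (heu ▸ hLx e he))
    · rcases Finset.mem_union.1 he with he | he <;> rcases Finset.mem_union.1 hf with hf | hf
      · exact hL.1.eq_of_snd_eq he hf hef
      · exact absurd hef (hLM e he f hf)
      · exact absurd hef.symm (hLM f hf e he)
      · exact hM.1.eq_of_snd_eq (hM'M he) (hM'M hf) hef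
  have hw := h.totalWeight_le_value hc
  rw [← hM.totalWeight_eq, ← hL.totalWeight_eq]
  unfold totalWeight at *
  rw [Finset.sum_union hd] at hw
  have := Finset.sum_filter_add_sum_filter_not M (fun e => (x, e.2) ∈ I.edges) I.weight
  linarith

lemma card_neighbors_eq_degreeY [Fintype X] (y : Y) :
    (Finset.univ.filter fun x : X => (x, y) ∈ I.edges).card = I.degreeY y := by
  refine Finset.card_bij (fun x _ => (x, y)) (by simp) (by simp) ?_
  rintro ⟨x, z⟩ h
  obtain ⟨h, rfl⟩ := Finset.mem_filter.1 h
  exact ⟨x, by simpa using h, rfl⟩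

lemma isSuperseparable_value [Fintype X] (hc : ∀ x : X, 0 ≤ I.capacity x) {p : ℝ}
    (hp : ∀ y : Y, (I.degreeY y : ℝ) ≤ p) : IsSuperseparable p I.value := by
  intro S
  obtain ⟨M, hM⟩ := exists_isMaxMatching hc S
  have hsum : ∑ x : X, ∑ e ∈ M.filter (fun e => (x, e.2) ∈ I.edges), I.weight e ≤
      p * I.value S := by
    simp_rw [Finset.sum_filter]
    -- Double counting: each `e ∈ M` contributes once per neighbour of `e.2`.
    rw [Finset.sum_comm, ← hM.totalWeight_eq, totalWeight, Finset.mul_sum]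
    refine Finset.sum_le_sum fun e he => ?_
    rw [← Finset.sum_filter, Finset.sum_const, card_neighbors_eq_degreeY, nsmul_eq_mul]
    exact mul_le_mul_of_nonneg_right (hp e.2) (hM.weight_nonneg he)
  have := Finset.sum_le_sum fun x (_ : x ∈ Finset.univ) => value_singleton_le hc hM x
  rw [Finset.sum_sub_distrib] at this
  linarith

end BMatchingInstance

theorem lemma2 {X Y : Type*} [Fintype X] [DecidableEq X] [Fintype Y] [DecidableEq Y]
    (I : BMatchingInstance X Y) (hc : ∀ x : X, 0 ≤ I.capacity x)
    (p : ℝ) (hp : ∀ y : Y, (I.degreeY y : ℝ) ≤ p) :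
    -- the maximum defining `value` is attained
    (∀ S : Finset X,
      IsGreatest {r : ℝ | ∃ M, I.IsMatching S M ∧ I.totalWeight M = r} (I.value S)) ∧
    -- the matching problem is the maximization of `value` over sets of size at most `K`
    (∀ K : ℕ,
      (∀ M : Finset (X × Y), I.IsOptimal K M ↔
        ∃ S : Finset X, IsBestKSubset I.value K S ∧ I.IsMaxMatching S M) ∧
      ∃ r : ℝ, IsGreatest {s : ℝ | ∃ M, I.IsFeasible K M ∧ I.totalWeight M = s} r ∧
        IsGreatest {s : ℝ | ∃ S : Finset X, S.card ≤ K ∧ I.value S = s} r) ∧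
    -- the properties of `value`
    (∀ S : Finset X, 0 ≤ I.value S) ∧
    Monotone I.value ∧
    IsSubmodular I.value ∧
    IsSuperseparable p I.value := by
  refine ⟨fun S => ?_, fun K => ⟨BMatchingInstance.isOptimal_iff hc K,
    BMatchingInstance.exists_common_optimum hc K⟩, BMatchingInstance.value_nonneg hc,
    BMatchingInstance.value_mono hc, BMatchingInstance.isSubmodular_value hc,
    BMatchingInstance.isSuperseparable_value hc hp⟩
  obtain ⟨M, hM⟩ := BMatchingInstance.exists_isMaxMatching hc S
  exact hM.totalWeight_eq ▸ hM.isGreatest
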